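/- Let $\beta_c=\sqrt{2\log 2}$ and let $\beta$ satisfy $\beta/\beta_c>1$. Let $(k_N)_{N\ge 1}$ be positive integers with $$k_N\to\infty,\qquad \frac{k_N}{N}\to\infty,\qquad \frac{\log k_N}{N}\to 0\qquad (N\to\infty).$$ On a probability space $(\Omega,\Sigma,\mathbb P)$ let, for every $N$, the energies $(H_N(\sigma))_{\sigma\in\{-1,+1\}^N}$ be i.i.d. Gaussian random variables with mean $0$ and variance $N$ (no assumption is made on the joint law for different $N$); in particular one may take the random energy model $$H_N(\sigma)=-\frac{N^{1/2}}{2^{N/2}}\sum_{\alpha\subset\{1,\dots,N\}}J_{\alpha}\prod_{i\in\alpha}\sigma_i ,$$ where, for each $N$, $(J_\alpha)_{\alpha\subset\{1,\dots,N\}}$ are i.i.d. standard Gaussians. Let $\mu_{N,\beta}$ be the Gibbs measure, i.e. the random probability measure on $\{-1,+1\}^N$ with weights $$\mu_{N,\beta}(\sigma)=\frac{e^{-\beta H_N(\sigma)}}{\sum_{\tau}e^{-\beta H_N(\tau)}}.$$ Let $\sigma^{(1)},\dots,\sigma^{(2^N)}$ be an enumeration of $\{-1,+1\}^N$ with $H_N(\sigma^{(1)})\le\dots\le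 H_N(\sigma^{(2^N)})$, and let $\mu^{(1)}_{k_N,\beta}$ be the random probability measure that gives the weight $$\frac{e^{-\beta H_N(\sigma^{(i)})}}{\sum_{j\le \min(k_N,2^N)}e^{-\beta H_N(\sigma^{(j)})}}$$ to $\sigma^{(i)}$ for $1\le i\le \min(k_N,2^N)$ and the weight $0$ to all other configurations. For measures $\mu,\nu$ on $\{-1,+1\}^N$ put $$d_{\mathrm{TV}}(\mu,\nu)=\sup_{\Psi:\ \|\Psi\|_\infty=1}\Big|\sum_\sigma\Psi(\sigma)\mu(\sigma)-\sum_\sigma\Psi(\sigma)\nu(\sigma)\Big|,$$ the supremum being over $\Psi:\{-1,+1\}^N\to\mathbb R$. Then, with probability $1$, for all but finitely many $N$ (and for every such enumeration, should there be ties), $$d_{\mathrm{TV}}\big(\mu_{N,\beta},\mu^{(1)}_{k_N,\beta}\big)\le\frac{4}{\beta/\beta_c-1}\cdot\frac{1}{(k_N-1)^{(\beta/\beta_c-1)/2}}.$$ -/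

import Mathlib

open MeasureTheory ProbabilityTheory Filter Topology
open scoped BigOperators

noncomputable section

namespace REM

/-- Spin configurations `{-1, +1}^N`; the units of `ℤ` are exactly `1` and `-1`. -/
abbrev Config (N : ℕ) : Type := Fin N → ℤˣ

/-- The critical inverse temperature `β_c = √(2 log 2)`. -/
def betaC : ℝ := √(2 * Real.log 2)

/-- `σ_α = ∏_{i ∈ α} σ_i`, with `σ_∅ = 1`. -/
def spinProd {N : ℕ} (α : Finset (Fin N)) (σ : Config N) : ℝ :=
  ∏ i ∈ α, ((σ i : ℤ) : ℝ)

/-- The REM Hamiltonian `H(σ) = -(N^{1/2} / 2^{N/2}) ∑_α J_α σ_α` built from couplings `J`. -/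
def hamiltonian {N : ℕ} (J : Finset (Fin N) → ℝ) (σ : Config N) : ℝ :=
  -(√(N : ℝ) / √((2 : ℝ) ^ N)) * ∑ α : Finset (Fin N), J α * spinProd α σ

/-- The partition function of the energies `E` at inverse temperature `β`. -/
def partitionFn {N : ℕ} (β : ℝ) (E : Config N → ℝ) : ℝ :=
  ∑ σ : Config N, Real.exp (-β * E σ)

/-- The Gibbs measure, given by the weights of the configurations. -/
def gibbs {N : ℕ} (β : ℝ) (E : Config N → ℝ) (σ : Config N) : ℝ :=
  Real.exp (-β * E σ) / partitionFn β E

/-- An enumeration of the configurations in the order of non-decreasing energy: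
`E (e 0) ≤ E (e 1) ≤ ...` (unique when the energies are distinct). -/
def IsEnergyOrdering {N : ℕ} (E : Config N → ℝ) (e : Fin (2 ^ N) ≃ Config N) : Prop :=
  Monotone fun i => E (e i)

/-- The Gibbs measure truncated to the first `k` configurations of the enumeration `e`,
given by the weights of the configurations. (Subtracting the lowest energy from all the energies
multiplies numerator and denominator by the same factor. If `k ≥ 2 ^ N`, nothing is cut off.) -/
def truncGibbs {N : ℕ} (β : ℝ) (E : Config N → ℝ) (e : Fin (2 ^ N) ≃ Config N) (k : ℕ)
    (σ : Config N) : ℝ :=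
  if (e.symm σ : ℕ) < k then
    Real.exp (-β * E σ) /
      ∑ i ∈ (Finset.univ : Finset (Fin (2 ^ N))).filter (fun i : Fin (2 ^ N) => (i : ℕ) < k),
        Real.exp (-β * E (e i))
  else 0

/-- The total variation distance `sup_{‖Ψ‖_∞ = 1} |μ(Ψ) - ν(Ψ)|` of two measures on the finite set
`Config N` given by their weights (`‖Ψ‖` is the sup norm, so this is twice the maximal difference
of the probabilities of an event). -/
def dTV {N : ℕ} (μ ν : Config N → ℝ) : ℝ :=
  sSup {x : ℝ | ∃ Ψ : Config N → ℝ, ‖Ψ‖ = 1 ∧ x = |∑ σ, Ψ σ * μ σ - ∑ σ, Ψ σ * ν σ|}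

/-- An enumeration in the order of non-decreasing energy always exists. -/
theorem exists_isEnergyOrdering {N : ℕ} (E : Config N → ℝ) :
    ∃ e : Fin (2 ^ N) ≃ Config N, IsEnergyOrdering E e := by
  have hc : Fintype.card (Config N) = 2 ^ N := by simp [Config]
  let e₀ : Fin (2 ^ N) ≃ Config N := (Fintype.equivFinOfCardEq hc).symm
  exact ⟨(Tuple.sort (E ∘ e₀)).trans e₀, Tuple.monotone_sort (E ∘ e₀)⟩

end REM

end

/-! Write b = β/β_c. Since 2^N exp(-β_c² N/2) = 1, the expected number of energies below -β_c N + s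
is at most e^{β_c s}/(β_c √(2πN)). The i-th lowest energy should thus exceed -β_c N by at least
about (log i)/β_c, up to a common shift, so its Boltzmann weight is at most of order i^{-b}. This is
summable because b > 1, and the tail beyond k is of order k^{1-b}.

Two one-sided estimates suffice. A union bound over i-subsets gives probability at most e^{-i} that
i energies lie below the level with e^{β_c s} = i/A, A = `countScale N`
(`measure_le_card_energy_le`). Independence gives probability at most 1/N² that none lies below the
level with e^{β_c s} = B, B = `groundScale N` (`measure_forall_lt_energy_le`). As k_N ≥ N + 1
eventually, both failure probabilities are summable and Borel-Cantelli applies.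

Deterministically, the Gibbs weight cut off is then at most (AB)^b (k-1)^{1-b}/(b-1)
(`dTV_le_of_card_lt`). The factors √N cancel in AB, leaving a constant times log N ≤ log(k-1); half
of the exponent b - 1 is given up to absorb its b-th power. -/

noncomputable section

namespace REM

/-! ### Counting independent variables below a level -/

section Counting

variable {Ω ι : Type*} [MeasurableSpace Ω] [Fintype ι] {P : Measure Ω} {E : ι → Ω → ℝ}

/-- Union bound for the number of independent variables below a level. -/
theorem measure_card_le_le (hE : iIndepFun E P) {t q : ℝ} (hq : 0 ≤ q)
    (hp : ∀ σ, P {ω | E σ ω ≤ t} ≤ ENNReal.ofReal q) (i : ℕ) :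
    P {ω | i ≤ (Finset.univ.filter fun σ => E σ ω ≤ t).card} ≤
      ENNReal.ofReal ((Fintype.card ι * q) ^ i / i.factorial) := by
  have hsub : {ω | i ≤ (Finset.univ.filter fun σ => E σ ω ≤ t).card} ⊆
      ⋃ S ∈ Finset.powersetCard i (Finset.univ : Finset ι), ⋂ σ ∈ S, E σ ⁻¹' Set.Iic t := by
    intro ω hω
    obtain ⟨S, hS, hc⟩ := Finset.exists_subset_card_eq hω
    simp only [Set.mem_iUnion, Set.mem_iInter, Finset.mem_powersetCard]
    exact ⟨S, ⟨Finset.subset_univ S, hc⟩, fun σ hσ => (Finset.mem_filter.1 (hS hσ)).2⟩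
  calc P {ω | i ≤ (Finset.univ.filter fun σ => E σ ω ≤ t).card}
      ≤ ∑ S ∈ Finset.powersetCard i (Finset.univ : Finset ι), P (⋂ σ ∈ S, E σ ⁻¹' Set.Iic t) :=
        (measure_mono hsub).trans (measure_biUnion_finset_le _ _)
    _ ≤ ∑ S ∈ Finset.powersetCard i (Finset.univ : Finset ι), ENNReal.ofReal (q ^ i) := by
        refine Finset.sum_le_sum fun S hS => ?_
        rw [hE.measure_inter_preimage_eq_mul S fun _ _ => measurableSet_Iic,
          ENNReal.ofReal_pow hq, ← (Finset.mem_powersetCard.1 hS).2]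
        exact Finset.prod_le_pow_card _ _ _ fun σ _ => hp σ
    _ = ENNReal.ofReal ((Fintype.card ι).choose i * q ^ i) := by
        rw [Finset.sum_const, Finset.card_powersetCard, Finset.card_univ, nsmul_eq_mul,
          ENNReal.ofReal_mul (by positivity), ENNReal.ofReal_natCast]
    _ ≤ _ := by
        refine ENNReal.ofReal_le_ofReal ?_
        rw [mul_pow, mul_div_right_comm]
        gcongr
        exact Nat.choose_le_pow_div i _

/-- By i^i/i! ≤ e^i, a mean of at most i e^{-2} turns the union bound into e^i e^{-2i}. -/
theorem measure_card_le_le_exp (hE : iIndepFun E P) {t q : ℝ} (hq : 0 ≤ q)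
    (hp : ∀ σ, P {ω | E σ ω ≤ t} ≤ ENNReal.ofReal q) {i : ℕ}
    (hi : Fintype.card ι * q ≤ i * Real.exp (-2)) :
    P {ω | i ≤ (Finset.univ.filter fun σ => E σ ω ≤ t).card} ≤
      ENNReal.ofReal (Real.exp (-(i : ℝ))) := by
  refine (measure_card_le_le hE hq hp i).trans (ENNReal.ofReal_le_ofReal ?_)
  calc (Fintype.card ι * q) ^ i / (i.factorial : ℝ)
      ≤ (i * Real.exp (-2)) ^ i / i.factorial := by gcongr
    _ = (i : ℝ) ^ i / i.factorial * Real.exp (-2) ^ i := by ring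
    _ ≤ Real.exp i * Real.exp (-2) ^ i := by
        gcongr
        exact Real.pow_div_factorial_le_exp _ (Nat.cast_nonneg i) i
    _ = Real.exp (-(i : ℝ)) := by
        rw [← Real.exp_nat_mul, ← Real.exp_add]
        ring_nf

/-- Probability that all of the independent variables exceed a level. -/
theorem measure_forall_lt_le [IsProbabilityMeasure P] (hE : iIndepFun E P)
    (hm : ∀ σ, AEMeasurable (E σ) P) {t q : ℝ}
    (hp : ∀ σ, ENNReal.ofReal q ≤ P {ω | E σ ω ≤ t}) :
    P {ω | ∀ σ, t < E σ ω} ≤ ENNReal.ofReal (Real.exp (-(Fintype.card ι * q))) := by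
  have hset : {ω | ∀ σ, t < E σ ω} = ⋂ σ ∈ (Finset.univ : Finset ι), E σ ⁻¹' Set.Ioi t := by
    ext ω; simp
  rw [hset, hE.measure_inter_preimage_eq_mul _ fun _ _ => measurableSet_Ioi]
  calc ∏ σ, P (E σ ⁻¹' Set.Ioi t) ≤ ∏ _σ : ι, ENNReal.ofReal (Real.exp (-q)) := by
        refine Finset.prod_le_prod' fun σ _ => ?_
        have hc : E σ ⁻¹' Set.Ioi t = {ω | E σ ω ≤ t}ᶜ := by ext ω; simp
        have hn : NullMeasurableSet {ω | E σ ω ≤ t} P :=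
          (hm σ).nullMeasurableSet_preimage measurableSet_Iic
        rw [hc, prob_compl_eq_one_sub₀ hn]
        -- For q ≤ 0 the claimed factor exp(-q) is at least 1.
        rcases le_total q 0 with h0 | h0
        · refine tsub_le_self.trans ?_
          rw [← ENNReal.ofReal_one]
          exact ENNReal.ofReal_le_ofReal (Real.one_le_exp (by linarith))
        calc 1 - P {ω | E σ ω ≤ t} ≤ ENNReal.ofReal 1 - ENNReal.ofReal q := by
              rw [ENNReal.ofReal_one]; exact tsub_le_tsub_left (hp σ) _
          _ = ENNReal.ofReal (1 - q) := (ENNReal.ofReal_sub _ h0).symm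
          _ ≤ _ := ENNReal.ofReal_le_ofReal (Real.one_sub_le_exp_neg q)
    _ = _ := by
        rw [Finset.prod_const, Finset.card_univ, ← ENNReal.ofReal_pow (Real.exp_nonneg _),
          ← Real.exp_nat_mul, mul_neg]

end Counting

/-! ### Gaussian tails around the level -β_c N -/

theorem betaC_pos : 0 < betaC := Real.sqrt_pos.2 (by have := Real.log_pos one_lt_two; linarith)

theorem exp_betaC_sq (N : ℕ) : Real.exp (-(betaC ^ 2 * N / 2)) = ((2 : ℝ) ^ N)⁻¹ := by
  have h : betaC ^ 2 = 2 * Real.log 2 :=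
    Real.sq_sqrt (by have := Real.log_pos one_lt_two; linarith)
  rw [Real.exp_neg, h, show 2 * Real.log 2 * (N : ℝ) / 2 = N * Real.log 2 by ring,
    Real.exp_nat_mul, Real.exp_log two_pos]

/-- Completing the square at -β_c N isolates the factor 2^{-N}, which cancels the number of
configurations. The rest is an exponential of rate β_c with a quadratic correction. -/
theorem gaussianPDFReal_eq_exp_betaC {N : ℕ} (hN : N ≠ 0) (x : ℝ) :
    gaussianPDFReal 0 (N : NNReal) x =
      (√(2 * Real.pi * N))⁻¹ * (((2 : ℝ) ^ N)⁻¹ *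
        Real.exp (betaC * (x + betaC * N) - (x + betaC * N) ^ 2 / (2 * N))) := by
  have hN' : (N : ℝ) ≠ 0 := Nat.cast_ne_zero.2 hN
  rw [gaussianPDFReal, ← exp_betaC_sq, ← Real.exp_add, NNReal.coe_natCast]
  congr 2
  field_simp
  ring

/-- Upper bound for the lower tail of the energies, valid at all levels. -/
theorem gaussianReal_Iic_le {N : ℕ} (hN : N ≠ 0) (s : ℝ) :
    gaussianReal 0 (N : NNReal) (Set.Iic (-(betaC * N) + s)) ≤
      ENNReal.ofReal (((2 : ℝ) ^ N)⁻¹ * (Real.exp (betaC * s) / (betaC * √(2 * Real.pi * N)))) := by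
  have hN' : (0 : ℝ) < N := Nat.cast_pos.2 (Nat.pos_of_ne_zero hN)
  have hc := betaC_pos
  have hint : IntegrableOn (fun x => Real.exp (betaC * x)) (Set.Iic (-(betaC * N) + s)) :=
    integrableOn_exp_mul_Iic hc _
  rw [gaussianReal_apply_eq_integral _ (by exact_mod_cast hN)]
  refine ENNReal.ofReal_le_ofReal ?_
  calc ∫ x in Set.Iic (-(betaC * N) + s), gaussianPDFReal 0 (N : NNReal) x
      ≤ ∫ x in Set.Iic (-(betaC * N) + s), (√(2 * Real.pi * N))⁻¹ * (((2 : ℝ) ^ N)⁻¹ *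
          Real.exp (betaC * (betaC * N))) * Real.exp (betaC * x) := by
        refine setIntegral_mono (integrable_gaussianPDFReal _ _).integrableOn
          (hint.const_mul _) fun x => ?_
        simp only
        rw [gaussianPDFReal_eq_exp_betaC hN, mul_assoc (√(2 * Real.pi * N))⁻¹,
          mul_assoc ((2 : ℝ) ^ N)⁻¹, ← Real.exp_add]
        gcongr
        -- Dropping the quadratic correction only enlarges the density and leaves an explicit
        -- integral.
        have : 0 ≤ (x + betaC * N) ^ 2 / (2 * N) := by positivity
        linarith
    _ = _ := by
        rw [integral_const_mul, integral_exp_mul_Iic hc, mul_add, Real.exp_add,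
          mul_neg, Real.exp_neg]
        field_simp

/-- Lower bound for the lower tail of the energies, near the ground state level. -/
theorem le_gaussianReal_Iic {N : ℕ} (hN : N ≠ 0) {s : ℝ} (hs : 1 ≤ s) (hsN : s ^ 2 ≤ 2 * N) :
    ENNReal.ofReal (((2 : ℝ) ^ N)⁻¹ * (Real.exp (betaC * (s - 1) - 1) / √(2 * Real.pi * N))) ≤
      gaussianReal 0 (N : NNReal) (Set.Iic (-(betaC * N) + s)) := by
  have hN' : (0 : ℝ) < N := Nat.cast_pos.2 (Nat.pos_of_ne_zero hN)
  have hc := betaC_pos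
  set a := -(betaC * N) + s with ha
  -- On the last unit interval below the level the linear term is at least β_c (s - 1), and the
  -- quadratic one costs at most 1.
  refine le_trans ?_ (measure_mono (Set.Ioc_subset_Iic_self : Set.Ioc (a - 1) a ⊆ _))
  rw [gaussianReal_apply_eq_integral _ (by exact_mod_cast hN)]
  refine ENNReal.ofReal_le_ofReal ?_
  calc ((2 : ℝ) ^ N)⁻¹ * (Real.exp (betaC * (s - 1) - 1) / √(2 * Real.pi * N))
      = ∫ x in Set.Ioc (a - 1) a,
          ((2 : ℝ) ^ N)⁻¹ * (Real.exp (betaC * (s - 1) - 1) / √(2 * Real.pi * N)) := by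
        simp
    _ ≤ _ := by
        refine setIntegral_mono_on (integrableOn_const (by simp))
          (integrable_gaussianPDFReal _ _).integrableOn measurableSet_Ioc fun x hx => ?_
        obtain ⟨h1, h2⟩ := hx
        have h3 : s - 1 ≤ x + betaC * N := by linarith
        have h4 : x + betaC * N ≤ s := by linarith
        rw [gaussianPDFReal_eq_exp_betaC hN, div_eq_inv_mul, mul_left_comm]
        gcongr
        rw [div_le_one (by positivity)]
        exact (pow_le_pow_left₀ (by linarith) h4 2).trans hsN

/-! ### The random energy model built from couplings -/

section Couplings

/-- Orthogonality of characters: the sum over subsets factorizes over sites, and a site where σ and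
τ differ contributes 1 - 1 = 0. -/
theorem sum_spinProd_mul_spinProd {N : ℕ} (σ τ : Config N) :
    ∑ α : Finset (Fin N), spinProd α σ * spinProd α τ = if σ = τ then (2 : ℝ) ^ N else 0 := by
  have h : ∑ α : Finset (Fin N), spinProd α σ * spinProd α τ =
      ∏ i, (1 + ((σ i : ℤ) : ℝ) * ((τ i : ℤ) : ℝ)) := by
    rw [Finset.prod_one_add, Finset.powerset_univ]
    simp [spinProd, Finset.prod_mul_distrib]
  rw [h]
  split_ifs with hst
  · subst hst
    have : ∀ i, (1 : ℝ) + ((σ i : ℤ) : ℝ) * ((σ i : ℤ) : ℝ) = 2 := fun i => by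
      rcases Int.units_eq_one_or (σ i) with h | h <;> rw [h] <;> norm_num
    simp [this]
  · obtain ⟨i, hi⟩ := Function.ne_iff.1 hst
    refine Finset.prod_eq_zero (Finset.mem_univ i) ?_
    rcases Int.units_eq_one_or (σ i) with h1 | h1 <;> rcases Int.units_eq_one_or (τ i) with h2 | h2
      <;> simp_all

variable {Ω : Type*} [MeasurableSpace Ω] {P : Measure Ω}

theorem hasGaussianLaw_of_hasLaw {X : Ω → ℝ} {m : ℝ} {v : NNReal}
    (hX : HasLaw X (gaussianReal m v) P) : HasGaussianLaw X P where
  isGaussian_map := by rw [hX.map_eq]; infer_instance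

variable {N : ℕ} {J : Finset (Fin N) → Ω → ℝ}

theorem hasGaussianLaw_hamiltonian (hJ : iIndepFun J P)
    (hJl : ∀ α, HasLaw (J α) (gaussianReal 0 1) P) :
    HasGaussianLaw (fun ω σ => hamiltonian (fun α => J α ω) σ) P := by
  let L : (Finset (Fin N) → ℝ) →ₗ[ℝ] (Config N → ℝ) :=
    { toFun := fun x σ => hamiltonian x σ
      map_add' := fun x y => by
        ext σ; simp [hamiltonian, add_mul, Finset.sum_add_distrib, mul_add]
      map_smul' := fun c x => by
        ext σ
        simp only [hamiltonian, Pi.smul_apply, smul_eq_mul, RingHom.id_apply, mul_assoc,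
          ← Finset.mul_sum]
        ring }
  exact (hJ.hasGaussianLaw fun α => hasGaussianLaw_of_hasLaw (hJl α)).map_fun
    (LinearMap.toContinuousLinearMap L)

theorem covariance_hamiltonian (hJ : iIndepFun J P)
    (hJl : ∀ α, HasLaw (J α) (gaussianReal 0 1) P) (σ τ : Config N) :
    cov[fun ω => hamiltonian (fun α => J α ω) σ, fun ω => hamiltonian (fun α => J α ω) τ; P] =
      if σ = τ then (N : ℝ) else 0 := by
  have := hJ.isProbabilityMeasure
  have h2 : ∀ α, MemLp (J α) 2 P := fun α => (hasGaussianLaw_of_hasLaw (hJl α)).memLp_two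
  have hc : ∀ α γ, cov[J α, J γ; P] = if α = γ then 1 else 0 := fun α γ => by
    split_ifs with h
    · subst h
      rw [covariance_self (hJl α).aemeasurable, (hJl α).variance_eq, variance_id_gaussianReal]
      rfl
    · exact (hJ.indepFun h).covariance_eq_zero (h2 α) (h2 γ)
  simp only [hamiltonian]
  rw [covariance_const_mul_left, covariance_const_mul_right, covariance_fun_sum_fun_sum]
  · simp only [covariance_mul_const_left, covariance_mul_const_right, hc, ite_mul, one_mul,
      zero_mul, Finset.sum_ite_eq, Finset.mem_univ, if_true]
    simp only [sum_spinProd_mul_spinProd]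
    split_ifs
    · have h1 : √(N : ℝ) * √(N : ℝ) = N := Real.mul_self_sqrt (Nat.cast_nonneg N)
      have h3 : √((2 : ℝ) ^ N) * √((2 : ℝ) ^ N) = 2 ^ N := Real.mul_self_sqrt (by positivity)
      have h4 : √((2 : ℝ) ^ N) ≠ 0 := by positivity
      field_simp
      nlinarith
    · simp
  · exact fun α => (h2 α).mul_const _
  · exact fun α => (h2 α).mul_const _

/-- The energies are jointly Gaussian, as a linear image of the couplings, so vanishing covariances
give independence. -/
theorem iIndepFun_hamiltonian (hJ : iIndepFun J P)
    (hJl : ∀ α, HasLaw (J α) (gaussianReal 0 1) P) :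
    iIndepFun (fun (σ : Config N) ω => hamiltonian (fun α => J α ω) σ) P :=
  (hasGaussianLaw_hamiltonian hJ hJl).iIndepFun_of_covariance_eq_zero fun σ τ h => by
    rw [covariance_hamiltonian hJ hJl, if_neg h]

theorem hasLaw_hamiltonian (hJ : iIndepFun J P)
    (hJl : ∀ α, HasLaw (J α) (gaussianReal 0 1) P) (σ : Config N) :
    HasLaw (fun ω => hamiltonian (fun α => J α ω) σ) (gaussianReal 0 (N : NNReal)) P := by
  have hg : HasGaussianLaw (fun ω => hamiltonian (fun α => J α ω) σ) P :=
    (hasGaussianLaw_hamiltonian hJ hJl).eval σ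
  refine ⟨hg.aemeasurable, ?_⟩
  have hi : ∀ α, Integrable (J α) P := fun α => (hasGaussianLaw_of_hasLaw (hJl α)).integrable
  have hm : P[fun ω => hamiltonian (fun α => J α ω) σ] = 0 := by
    simp only [hamiltonian]
    rw [integral_const_mul, integral_finsetSum _ fun α _ => (hi α).mul_const _]
    simp [integral_mul_const, (hJl _).integral_eq]
  rw [hg.map_eq_gaussianReal, hm, ← covariance_self hg.aemeasurable,
    covariance_hamiltonian hJ hJl, if_pos rfl, Real.toNNReal_natCast]

end Couplings

/-! ### Deterministic truncation bound -/

section Truncation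

theorem partitionFn_pos {N : ℕ} (β : ℝ) (E : Config N → ℝ) : 0 < partitionFn β E :=
  Finset.sum_pos (fun _ _ => Real.exp_pos _) Finset.univ_nonempty

/-- The truncation error is at most twice the Gibbs weight of the configurations cut off. -/
theorem dTV_gibbs_truncGibbs_le {N : ℕ} (β : ℝ) (E : Config N → ℝ) (e : Fin (2 ^ N) ≃ Config N)
    {k : ℕ} (hk : 0 < k) :
    dTV (gibbs β E) (truncGibbs β E e k) ≤
      2 * ((∑ i ∈ Finset.univ.filter (fun i : Fin (2 ^ N) => ¬ (i : ℕ) < k), Real.exp (-β * E (e i))) /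
        partitionFn β E) := by
  set w : Fin (2 ^ N) → ℝ := fun i => Real.exp (-β * E (e i)) with hw
  have hw0 : ∀ i, 0 < w i := fun i => Real.exp_pos _
  set D := partitionFn β E with hD
  set S := ∑ i ∈ Finset.univ.filter (fun i : Fin (2 ^ N) => (i : ℕ) < k), w i with hS
  set T := ∑ i ∈ Finset.univ.filter (fun i : Fin (2 ^ N) => ¬ (i : ℕ) < k), w i with hT
  have hDpos : 0 < D := partitionFn_pos β E
  have hTpos : 0 ≤ T := Finset.sum_nonneg fun i _ => (hw0 i).le
  have hSpos : 0 < S := Finset.sum_pos (fun i _ => hw0 i)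
    ⟨⟨0, by positivity⟩, by simpa using hk⟩
  have hDST : D = S + T := by
    rw [hS, hT, Finset.sum_filter_add_sum_filter_not, hD, partitionFn]
    exact (Equiv.sum_comp e fun σ => Real.exp (-β * E σ)).symm
  -- Truncation moves the cut-off mass T/D onto the kept configurations, so it is counted once as a
  -- loss and once as a gain.
  have hdiff : ∑ σ, |gibbs β E σ - truncGibbs β E e k σ| = 2 * (T / D) := by
    rw [← Equiv.sum_comp e, ← Finset.sum_filter_add_sum_filter_not _ fun i : Fin (2 ^ N) =>
      (i : ℕ) < k]
    have h1 : ∑ i ∈ Finset.univ.filter (fun i : Fin (2 ^ N) => (i : ℕ) < k), |gibbs β E (e i) - truncGibbs β E e k (e i)| =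
        ∑ i ∈ Finset.univ.filter (fun i : Fin (2 ^ N) => (i : ℕ) < k), w i * (1 / S - 1 / D) := by
      refine Finset.sum_congr rfl fun i hi => ?_
      have hle : 1 / D ≤ 1 / S := one_div_le_one_div_of_le hSpos (by linarith)
      have hg : gibbs β E (e i) = w i * (1 / D) := by simp [gibbs, hw, hD, div_eq_mul_inv]
      have ht : truncGibbs β E e k (e i) = w i * (1 / S) := by
        rw [truncGibbs, Equiv.symm_apply_apply, if_pos (Finset.mem_filter.1 hi).2]
        simp [hw, hS, div_eq_mul_inv]
      rw [hg, ht, ← mul_sub, abs_mul, abs_of_pos (hw0 i), abs_sub_comm,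
        abs_of_nonneg (sub_nonneg.2 hle)]
    have h2 : ∑ i ∈ Finset.univ.filter (fun i : Fin (2 ^ N) => ¬ (i : ℕ) < k),
        |gibbs β E (e i) - truncGibbs β E e k (e i)| =
        ∑ i ∈ Finset.univ.filter (fun i : Fin (2 ^ N) => ¬ (i : ℕ) < k), w i * (1 / D) := by
      refine Finset.sum_congr rfl fun i hi => ?_
      have hg : gibbs β E (e i) = w i * (1 / D) := by simp [gibbs, hw, hD, div_eq_mul_inv]
      rw [truncGibbs, Equiv.symm_apply_apply, if_neg (Finset.mem_filter.1 hi).2, sub_zero, hg,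
        abs_of_pos (mul_pos (hw0 i) (by positivity))]
    rw [h1, h2, ← Finset.sum_mul, ← Finset.sum_mul, ← hS, ← hT]
    field_simp
    rw [hDST]
    ring
  refine Real.sSup_le ?_ (by positivity)
  rintro x ⟨Ψ, hΨ, rfl⟩
  rw [← Finset.sum_sub_distrib, ← hdiff]
  refine (Finset.abs_sum_le_sum_abs _ _).trans (Finset.sum_le_sum fun σ _ => ?_)
  rw [← mul_sub, abs_mul]
  have : |Ψ σ| ≤ 1 := by rw [← hΨ]; exact norm_le_pi_norm Ψ σ
  exact mul_le_of_le_one_left (abs_nonneg _) this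

/-- Comparison with the integral of x^{-b} from k - 1; the assumption 2 ≤ k keeps the singularity at
0 outside. -/
theorem sum_Ico_rpow_neg_le {b : ℝ} (hb : 1 < b) {k : ℕ} (hk : 2 ≤ k) (n : ℕ) :
    ∑ i ∈ Finset.Ico k n, (i : ℝ) ^ (-b) ≤ ((k : ℝ) - 1) ^ (1 - b) / (b - 1) := by
  obtain ⟨m, rfl⟩ : ∃ m, k = m + 1 := ⟨k - 1, by omega⟩
  have hm : (0 : ℝ) < m := by exact_mod_cast (by omega : 0 < m)
  rcases le_total n (m + 1) with hn | hn
  · rw [Finset.Ico_eq_empty_of_le hn, Finset.sum_empty]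
    exact div_nonneg (Real.rpow_nonneg (by push_cast; linarith) _) (by linarith)
  obtain ⟨l, rfl⟩ : ∃ l, n = l + 1 := ⟨n - 1, by omega⟩
  have hml : m ≤ l := by omega
  have hmlR : (m : ℝ) ≤ l := by exact_mod_cast hml
  rw [← Finset.sum_Ico_add' (fun i : ℕ => (i : ℝ) ^ (-b)) m l 1]
  have hanti : AntitoneOn (fun x : ℝ => x ^ (-b)) (Set.Icc m l) := fun x hx y _ hxy =>
    Real.rpow_le_rpow_of_nonpos (hm.trans_le hx.1) hxy (by linarith)
  refine (hanti.sum_le_integral_Ico hml).trans ?_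
  rw [integral_rpow (Or.inr ⟨by linarith, ?_⟩)]
  · have h0 : 0 ≤ (l : ℝ) ^ (-b + 1) := Real.rpow_nonneg (by linarith) _
    rw [show -b + 1 = -(b - 1) by ring, div_neg, ← neg_div] at *
    push_cast
    rw [show (1 : ℝ) - b = -(b - 1) by ring, add_sub_cancel_right]
    have : 0 < b - 1 := by linarith
    gcongr
    linarith
  · rw [Set.uIcc_of_le hmlR]
    exact fun h => absurd h.1 (not_le.2 hm)

/-- Truncation error for energies with controlled counting function and ground state. -/
theorem dTV_le_of_card_lt {N : ℕ} {b A B : ℝ} (hb : 1 < b) (hA : 0 < A) (hB : 0 < B)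
    {E : Config N → ℝ} {e : Fin (2 ^ N) ≃ Config N} (he : IsEnergyOrdering E e)
    {k : ℕ} (hk : 2 ≤ k)
    (hcount : ∀ i, k ≤ i → (Finset.univ.filter fun σ =>
      E σ ≤ -(betaC * N) + Real.log (i / A) / betaC).card < i)
    (hmin : ∃ σ, E σ ≤ -(betaC * N) + Real.log B / betaC) :
    dTV (gibbs (b * betaC) E) (truncGibbs (b * betaC) E e k) ≤
      2 * ((A * B) ^ b * (((k : ℝ) - 1) ^ (1 - b) / (b - 1))) := by
  have hc := betaC_pos
  have hb0 : 0 < b := by linarith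
  set M := Real.exp (b * betaC * (betaC * N)) with hM
  have hMpos : 0 < M := Real.exp_pos _
  -- At these logarithmic levels Boltzmann weights are powers of x, with a common factor M that
  -- cancels against the partition function.
  have hexp : ∀ x : ℝ, 0 < x → Real.exp (-(b * betaC) * (-(betaC * N) + Real.log x / betaC)) =
      M * x ^ (-b) := fun x hx => by
    rw [Real.rpow_def_of_pos hx, hM, ← Real.exp_add]
    congr 1
    field_simp
    ring
  have hD : M * B ^ (-b) ≤ partitionFn (b * betaC) E := by
    obtain ⟨σ, hσ⟩ := hmin
    rw [← hexp B hB]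
    refine le_trans (Real.exp_le_exp.2 ?_) (Finset.single_le_sum
      (f := fun σ => Real.exp (-(b * betaC) * E σ)) (fun _ _ => (Real.exp_pos _).le)
      (Finset.mem_univ σ))
    exact mul_le_mul_of_nonpos_left hσ (by nlinarith)
  have hT : ∑ i ∈ Finset.univ.filter (fun i : Fin (2 ^ N) => ¬ (i : ℕ) < k), Real.exp (-(b * betaC) * E (e i)) ≤
      M * A ^ b * (((k : ℝ) - 1) ^ (1 - b) / (b - 1)) := by
    have hterm : ∀ i : Fin (2 ^ N), ¬ (i : ℕ) < k →
        Real.exp (-(b * betaC) * E (e i)) ≤ M * A ^ b * ((i : ℕ) : ℝ) ^ (-b) := fun i hi => by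
      have hi0 : (0 : ℝ) < ((i : ℕ) : ℝ) := by exact_mod_cast (by omega : 0 < (i : ℕ))
      have hlt : -(betaC * N) + Real.log ((i : ℕ) / A) / betaC < E (e i) := by
        -- Indices start at 0, so exactly i configurations precede `e i`; all would lie below the
        -- level, contradicting the count.
        by_contra! hle
        refine absurd (hcount i (not_lt.1 hi)) (not_lt.2 ?_)
        calc (i : ℕ) = ((Finset.Iio i).map e.toEmbedding).card := by simp
          _ ≤ _ := Finset.card_le_card fun σ hσ => by
            obtain ⟨j, hj, rfl⟩ := Finset.mem_map.1 hσ
            exact Finset.mem_filter.2 ⟨Finset.mem_univ _,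
              (he (Finset.mem_Iio.1 hj).le).trans hle⟩
      calc Real.exp (-(b * betaC) * E (e i)) ≤ M * (((i : ℕ) : ℝ) / A) ^ (-b) := by
            rw [← hexp _ (by positivity)]
            exact Real.exp_le_exp.2 (mul_le_mul_of_nonpos_left hlt.le (by nlinarith))
        _ = _ := by
            rw [Real.div_rpow hi0.le hA.le, Real.rpow_neg hA.le, div_inv_eq_mul]
            ring
    calc ∑ i ∈ Finset.univ.filter (fun i : Fin (2 ^ N) => ¬ (i : ℕ) < k), Real.exp (-(b * betaC) * E (e i))
        ≤ ∑ i ∈ Finset.univ.filter (fun i : Fin (2 ^ N) => ¬ (i : ℕ) < k), M * A ^ b * ((i : ℕ) : ℝ) ^ (-b) :=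
          Finset.sum_le_sum fun i hi => hterm i (Finset.mem_filter.1 hi).2
      _ = M * A ^ b * ∑ i ∈ Finset.Ico k (2 ^ N), (i : ℝ) ^ (-b) := by
          rw [← Finset.mul_sum, Finset.sum_filter,
            Fin.sum_univ_eq_sum_range (fun i : ℕ => if ¬ i < k then (i : ℝ) ^ (-b) else 0),
            ← Finset.sum_filter]
          congr 2
          ext i
          simp [and_comm]
      _ ≤ _ := by
          gcongr
          exact sum_Ico_rpow_neg_le hb hk _
  have hR : 0 ≤ ((k : ℝ) - 1) ^ (1 - b) / (b - 1) := by
    have : (2 : ℝ) ≤ k := by exact_mod_cast hk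
    exact div_nonneg (Real.rpow_nonneg (by linarith) _) (by linarith)
  refine (dTV_gibbs_truncGibbs_le _ E e (by omega)).trans ?_
  gcongr
  rw [div_le_iff₀ (partitionFn_pos _ _)]
  calc _ ≤ M * A ^ b * (((k : ℝ) - 1) ^ (1 - b) / (b - 1)) := hT
    _ = (A * B) ^ b * (((k : ℝ) - 1) ^ (1 - b) / (b - 1)) * (M * B ^ (-b)) := by
        rw [Real.mul_rpow hA.le hB.le, Real.rpow_neg hB.le]
        have : B ^ b ≠ 0 := by positivity
        field_simp
    _ ≤ _ := by gcongr

end Truncation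

/-! ### Probability estimates and Borel-Cantelli -/

section AlmostSure

/-- Borel-Cantelli lemma for a bound that holds eventually. -/
theorem ae_eventually_notMem_of_eventually_le {Ω : Type*} [MeasurableSpace Ω] {P : Measure Ω}
    {s : ℕ → Set Ω} {g : ℕ → ℝ} (hg : Summable g) (hg0 : ∀ n, 0 ≤ g n)
    (h : ∀ᶠ n in atTop, P (s n) ≤ ENNReal.ofReal (g n)) :
    ∀ᵐ ω ∂P, ∀ᶠ n in atTop, ω ∉ s n := by
  obtain ⟨n₀, hn₀⟩ := eventually_atTop.1 h
  have hsum : ∑' n, P (s (n + n₀)) ≠ ⊤ := by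
    refine ne_top_of_le_ne_top ?_ (ENNReal.tsum_le_tsum fun n => hn₀ (n + n₀) (by omega))
    rw [← ENNReal.ofReal_tsum_of_nonneg (fun n => hg0 _) ((summable_nat_add_iff n₀).2 hg)]
    exact ENNReal.ofReal_ne_top
  filter_upwards [ae_eventually_notMem hsum] with ω hω
  obtain ⟨m, hm⟩ := eventually_atTop.1 hω
  refine eventually_atTop.2 ⟨m + n₀, fun n hn => ?_⟩
  have := hm (n - n₀) (by omega)
  rwa [Nat.sub_add_cancel (by omega)] at this

/-- `countScale N * exp (betaC * s)` is, up to a factor `exp 2`, a bound for the expected number of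
energies below `-betaC * N + s`. -/
def countScale (N : ℕ) : ℝ := Real.exp 2 / (betaC * √(2 * Real.pi * N))

/-- `exp (betaC * s)` for a level `-betaC * N + s` that the ground state energy does not exceed. -/
def groundScale (N : ℕ) : ℝ :=
  Real.exp (betaC + 1) * √(2 * Real.pi * N) * (2 * Real.log N)

theorem countScale_pos {N : ℕ} (hN : N ≠ 0) : 0 < countScale N := by
  have := betaC_pos
  have : (0 : ℝ) < N := Nat.cast_pos.2 (Nat.pos_of_ne_zero hN)
  unfold countScale
  positivity

theorem groundScale_pos {N : ℕ} (hN : 2 ≤ N) : 0 < groundScale N := by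
  have h1 : (1 : ℝ) < N := by exact_mod_cast hN
  have := Real.log_pos h1
  unfold groundScale
  positivity

theorem countScale_mul_groundScale {N : ℕ} (hN : N ≠ 0) :
    countScale N * groundScale N = 2 * Real.exp (betaC + 3) / betaC * Real.log N := by
  have hc := betaC_pos
  have hN' : (0 : ℝ) < N := Nat.cast_pos.2 (Nat.pos_of_ne_zero hN)
  have h3 : Real.exp (betaC + 3) = Real.exp 2 * Real.exp (betaC + 1) := by
    rw [← Real.exp_add]; ring_nf
  rw [countScale, groundScale, h3]
  have : √(2 * Real.pi * N) ≠ 0 := by positivity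
  field_simp

/-- These are the conditions of `le_gaussianReal_Iic` at the ground state level. They hold because
log B is of order log N, hence negligible against √N. -/
theorem eventually_log_groundScale :
    ∀ᶠ N : ℕ in atTop, 1 ≤ Real.log (groundScale N) / betaC ∧
      (Real.log (groundScale N) / betaC) ^ 2 ≤ 2 * N := by
  have hc := betaC_pos
  set K := Real.log (Real.exp (betaC + 1) * √(2 * Real.pi) * 2) with hK
  have hlo : (fun x : ℝ => K + 2 * Real.log x) =o[atTop] fun x : ℝ => x ^ (1 / 2 : ℝ) :=
    ((Asymptotics.isLittleO_const_left.2 (Or.inr (tendsto_norm_atTop_atTop.comp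
      (tendsto_rpow_atTop (by norm_num)))))).add
      ((isLittleO_log_rpow_atTop (by norm_num)).const_mul_left 2)
  have hev := tendsto_natCast_atTop_atTop.eventually (hlo.def hc)
  filter_upwards [hev, eventually_ge_atTop 3] with N hN h3
  have h3R : (3 : ℝ) ≤ N := by exact_mod_cast h3
  have hN0 : (0 : ℝ) < N := by linarith
  have hlog1 : 1 ≤ Real.log N := by
    rw [Real.le_log_iff_exp_le hN0]
    exact Real.exp_one_lt_three.le.trans h3R
  have hsqrt1 : 1 ≤ √(2 * Real.pi * N) := by
    rw [Real.one_le_sqrt]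
    nlinarith [Real.pi_gt_three]
  have hlow : betaC ≤ Real.log (groundScale N) := by
    rw [Real.le_log_iff_exp_le (groundScale_pos (by omega)), groundScale]
    calc Real.exp betaC ≤ Real.exp (betaC + 1) * 1 * 1 := by
          rw [mul_one, mul_one]; exact Real.exp_le_exp.2 (by linarith)
      _ ≤ _ := by gcongr; linarith
  refine ⟨(one_le_div hc).2 hlow, ?_⟩
  have hup : Real.log (groundScale N) ≤ K + 2 * Real.log N := by
    have hle : groundScale N ≤ Real.exp (betaC + 1) * √(2 * Real.pi) * 2 * (N : ℝ) ^ 2 := by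
      rw [groundScale, Real.sqrt_mul (by positivity)]
      have h1 : √(N : ℝ) ≤ N := by
        rw [Real.sqrt_le_left hN0.le]; nlinarith
      have h2 : Real.log N ≤ N := (Real.log_le_sub_one_of_pos hN0).trans (by linarith)
      calc _ ≤ Real.exp (betaC + 1) * (√(2 * Real.pi) * N) * (2 * N) := by gcongr
        _ = _ := by ring
    refine (Real.log_le_log (groundScale_pos (by omega)) hle).trans_eq ?_
    rw [Real.log_mul (by positivity) (by positivity), Real.log_pow]
    norm_num [hK]
  have hrt : ‖(N : ℝ) ^ (1 / 2 : ℝ)‖ = √(N : ℝ) := by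
    rw [Real.sqrt_eq_rpow, Real.norm_of_nonneg (by positivity)]
  rw [hrt] at hN
  have hle : Real.log (groundScale N) / betaC ≤ √(N : ℝ) := by
    rw [div_le_iff₀ hc, mul_comm]
    exact hup.trans ((le_abs_self _).trans hN)
  calc _ ≤ √(N : ℝ) ^ 2 := by
        have : 0 ≤ Real.log (groundScale N) / betaC := div_nonneg (hc.le.trans hlow) hc.le
        gcongr
    _ = N := Real.sq_sqrt hN0.le
    _ ≤ _ := by linarith

variable {Ω : Type*} [MeasurableSpace Ω] {P : Measure Ω} {N : ℕ}
  {H : Config N → Ω → ℝ}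

theorem card_config (N : ℕ) : (Fintype.card (Config N) : ℝ) = 2 ^ N := by
  simp [Config]

theorem measure_le_card_energy_le (hH : iIndepFun H P)
    (hl : ∀ σ, HasLaw (H σ) (gaussianReal 0 (N : NNReal)) P) (hN : N ≠ 0) {i : ℕ} (hi : 0 < i) :
    P {ω | i ≤ (Finset.univ.filter fun σ =>
      H σ ω ≤ -(betaC * N) + Real.log (i / countScale N) / betaC).card} ≤
      ENNReal.ofReal (Real.exp (-(i : ℝ))) := by
  have hc := betaC_pos
  have hA := countScale_pos hN
  have hi' : (0 : ℝ) < i := Nat.cast_pos.2 hi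
  have hN' : (0 : ℝ) < N := Nat.cast_pos.2 (Nat.pos_of_ne_zero hN)
  refine measure_card_le_le_exp hH ?_ (fun σ => ?_) ?_ (q := ((2 : ℝ) ^ N)⁻¹ *
    (Real.exp (betaC * (Real.log (i / countScale N) / betaC)) / (betaC * √(2 * Real.pi * N))))
  · positivity
  · rw [(hl σ).measure_eq measurableSet_Iic]
    exact gaussianReal_Iic_le hN _
  · rw [mul_div_cancel₀ _ hc.ne', Real.exp_log (by positivity), card_config,
      mul_inv_cancel_left₀ (by positivity), countScale, Real.exp_neg]
    apply le_of_eq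
    have : √(2 * Real.pi * N) ≠ 0 := by positivity
    field_simp

theorem measure_forall_lt_energy_le [IsProbabilityMeasure P] (hH : iIndepFun H P)
    (hl : ∀ σ, HasLaw (H σ) (gaussianReal 0 (N : NNReal)) P) (hN : 2 ≤ N)
    (h1 : 1 ≤ Real.log (groundScale N) / betaC)
    (h2 : (Real.log (groundScale N) / betaC) ^ 2 ≤ 2 * N) :
    P {ω | ∀ σ, -(betaC * N) + Real.log (groundScale N) / betaC < H σ ω} ≤
      ENNReal.ofReal (1 / (N : ℝ) ^ 2) := by
  have hc := betaC_pos
  have hN' : (0 : ℝ) < N := by exact_mod_cast (by omega : 0 < N)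
  refine (measure_forall_lt_le hH (fun σ => (hl σ).aemeasurable) (q := ((2 : ℝ) ^ N)⁻¹ *
    (Real.exp (betaC * (Real.log (groundScale N) / betaC - 1) - 1) / √(2 * Real.pi * N)))
    fun σ => ?_).trans_eq ?_
  · rw [(hl σ).measure_eq measurableSet_Iic]
    exact le_gaussianReal_Iic (by omega) h1 h2
  · congr 1
    have hsqrt : √(2 * Real.pi * N) ≠ 0 := by positivity
    -- The factor e^{β_c+1} in B pays for the losses β_c and 1 in the lower tail bound. What remains
    -- is a mean of at least 2 log N, whence the probability N^{-2}.
    have he : Real.exp (betaC * (Real.log (groundScale N) / betaC - 1) - 1) =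
        groundScale N / Real.exp (betaC + 1) := by
      rw [mul_sub, mul_div_cancel₀ _ hc.ne', mul_one, sub_sub, Real.exp_sub,
        Real.exp_log (groundScale_pos hN)]
    rw [he, card_config, mul_inv_cancel_left₀ (by positivity), groundScale]
    have hq : Real.exp (betaC + 1) * √(2 * Real.pi * N) * (2 * Real.log N) /
        Real.exp (betaC + 1) / √(2 * Real.pi * N) = Real.log ((N : ℝ) ^ 2) := by
      rw [Real.log_pow]
      field_simp
      push_cast
      ring
    rw [hq, Real.exp_neg, Real.exp_log (by positivity), one_div]

theorem tsum_ofReal_exp_neg_add (k : ℕ) :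
    ∑' i : ℕ, ENNReal.ofReal (Real.exp (-((k + i : ℕ) : ℝ))) =
      ENNReal.ofReal (Real.exp (-1) ^ k * (1 - Real.exp (-1))⁻¹) := by
  have h1 : Real.exp (-1) < 1 := by simp
  have he : ∀ i : ℕ, Real.exp (-((k + i : ℕ) : ℝ)) = Real.exp (-1) ^ k * Real.exp (-1) ^ i :=
    fun i => by
      rw [← pow_add, ← Real.exp_nat_mul]
      ring_nf
  simp only [he]
  rw [← ENNReal.ofReal_tsum_of_nonneg (fun i => by positivity)
    ((summable_geometric_of_lt_one (Real.exp_nonneg _) h1).mul_left _), tsum_mul_left,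
    tsum_geometric_of_lt_one (Real.exp_nonneg _) h1]

theorem measure_exists_le_card_energy_le (hH : iIndepFun H P)
    (hl : ∀ σ, HasLaw (H σ) (gaussianReal 0 (N : NNReal)) P) (hN : N ≠ 0) {k : ℕ} (hk : 0 < k) :
    P {ω | ∃ i, k ≤ i ∧ i ≤ (Finset.univ.filter fun σ =>
      H σ ω ≤ -(betaC * N) + Real.log (i / countScale N) / betaC).card} ≤
      ENNReal.ofReal (Real.exp (-1) ^ k * (1 - Real.exp (-1))⁻¹) := by
  rw [← tsum_ofReal_exp_neg_add]
  refine (measure_mono ?_).trans ((measure_iUnion_le fun i : ℕ => {ω | k + i ≤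
    (Finset.univ.filter fun σ =>
      H σ ω ≤ -(betaC * N) + Real.log ((k + i : ℕ) / countScale N) / betaC).card}).trans
    (ENNReal.tsum_le_tsum fun i => measure_le_card_energy_le hH hl hN (by omega)))
  rintro ω ⟨i, hki, hi⟩
  obtain ⟨j, rfl⟩ := Nat.exists_eq_add_of_le hki
  exact Set.mem_iUnion.2 ⟨j, hi⟩

/-- The polynomial loss allowed in the truncation bound absorbs powers of the logarithm. -/
theorem eventually_log_rpow_le {b C : ℝ} (hb : 1 < b) (hC : 0 < C) :
    ∀ᶠ x : ℝ in atTop, 2 * ((C * Real.log x) ^ b * (x ^ (1 - b) / (b - 1))) ≤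
      4 / (b - 1) * (1 / x ^ ((b - 1) / 2)) := by
  have hb0 : 0 < b := by linarith
  have hb1 : 0 < b - 1 := by linarith
  -- The exponent is divided by b because the logarithm is raised to the power b afterwards.
  have hlo : (fun x : ℝ => C * Real.log x) =o[atTop] fun x : ℝ => x ^ ((b - 1) / 2 / b) :=
    (isLittleO_log_rpow_atTop (by positivity)).const_mul_left C
  filter_upwards [hlo.def one_pos, eventually_ge_atTop 1] with x hx hx1
  have hx0 : 0 < x := by linarith
  have hle : (C * Real.log x) ^ b ≤ x ^ ((b - 1) / 2) := by
    calc (C * Real.log x) ^ b ≤ (x ^ ((b - 1) / 2 / b)) ^ b := by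
          refine Real.rpow_le_rpow (mul_nonneg hC.le (Real.log_nonneg hx1)) ?_ hb0.le
          rw [one_mul, Real.norm_of_nonneg (Real.rpow_nonneg hx0.le _)] at hx
          exact (le_abs_self _).trans hx
      _ = _ := by rw [← Real.rpow_mul hx0.le, div_mul_cancel₀ _ hb0.ne']
  calc 2 * ((C * Real.log x) ^ b * (x ^ (1 - b) / (b - 1)))
      ≤ 2 * (x ^ ((b - 1) / 2) * (x ^ (1 - b) / (b - 1))) := by gcongr
    _ = 2 / (b - 1) * (x ^ ((b - 1) / 2) * x ^ (1 - b)) := by ring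
    _ = 2 / (b - 1) * (1 / x ^ ((b - 1) / 2)) := by
        rw [← Real.rpow_add hx0, one_div, ← Real.rpow_neg hx0.le]
        congr 2
        ring
    _ ≤ _ := by gcongr; norm_num

theorem ae_eventually_dTV_le [IsProbabilityMeasure P] {b : ℝ} (hb : 1 < b) {k : ℕ → ℕ}
    (hkN : ∀ᶠ N : ℕ in atTop, N + 1 ≤ k N) {H : (N : ℕ) → Config N → Ω → ℝ}
    (hH : ∀ N, iIndepFun (H N) P)
    (hl : ∀ N σ, HasLaw (H N σ) (gaussianReal 0 (N : NNReal)) P) :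
    ∀ᵐ ω ∂P, ∀ᶠ N : ℕ in atTop, ∀ e : Fin (2 ^ N) ≃ Config N,
      IsEnergyOrdering (fun σ => H N σ ω) e →
      dTV (gibbs (b * betaC) fun σ => H N σ ω)
          (truncGibbs (b * betaC) (fun σ => H N σ ω) e (k N)) ≤
        4 / (b - 1) * (1 / ((k N : ℝ) - 1) ^ ((b - 1) / 2)) := by
  have hc := betaC_pos
  set r := Real.exp (-1)
  have hr0 : 0 < r := Real.exp_pos _
  have hr1 : r < 1 := Real.exp_lt_one_iff.2 (by norm_num)
  have hinv : 0 ≤ (1 - r)⁻¹ := inv_nonneg.2 (by linarith)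
  have hmin := ae_eventually_notMem_of_eventually_le (P := P)
    (s := fun N => {ω | ∀ σ, -(betaC * N) + Real.log (groundScale N) / betaC < H N σ ω})
    (g := fun N => 1 / (N : ℝ) ^ 2) (Real.summable_one_div_nat_pow.2 one_lt_two)
    (fun N => by positivity) (by
      filter_upwards [eventually_log_groundScale, eventually_ge_atTop 2] with N h1 h2
      exact measure_forall_lt_energy_le (hH N) (hl N) h2 h1.1 h1.2)
  have hcount := ae_eventually_notMem_of_eventually_le (P := P)
    (s := fun N => {ω | ∃ i, k N ≤ i ∧ i ≤ (Finset.univ.filter fun σ =>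
      H N σ ω ≤ -(betaC * N) + Real.log (i / countScale N) / betaC).card})
    (g := fun N => r ^ N * (1 - r)⁻¹)
    ((summable_geometric_of_lt_one hr0.le hr1).mul_right _)
    (fun N => by positivity) (by
      filter_upwards [hkN, eventually_ge_atTop 1] with N h1 h2
      refine (measure_exists_le_card_energy_le (hH N) (hl N) (by omega) (by omega)).trans
        (ENNReal.ofReal_le_ofReal ?_)
      -- With k_N ≥ N + 1 the geometric tail from k_N is dominated by r^N, which is summable.
      exact mul_le_mul_of_nonneg_right (pow_le_pow_of_le_one hr0.le hr1.le (by omega)) hinv)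
  set C := 2 * Real.exp (betaC + 3) / betaC with hC
  have hCpos : 0 < C := by positivity
  have hkt : Tendsto (fun N => (k N : ℝ) - 1) atTop atTop := by
    refine tendsto_atTop_mono' _ ?_ tendsto_natCast_atTop_atTop
    filter_upwards [hkN] with N h
    have : ((N + 1 : ℕ) : ℝ) ≤ k N := by exact_mod_cast h
    push_cast at this
    linarith
  have hlog := hkt.eventually (eventually_log_rpow_le hb hCpos)
  filter_upwards [hmin, hcount] with ω h1 h2
  filter_upwards [h1, h2, hkN, hlog, eventually_ge_atTop 2] with N h1 h2 h3 h4 h5 e he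
  simp only [not_forall, not_lt] at h1
  simp only [not_exists, not_and, not_le] at h2
  refine (dTV_le_of_card_lt hb (countScale_pos (by omega)) (groundScale_pos h5) he (by omega)
    h2 h1).trans (le_trans ?_ h4)
  rw [countScale_mul_groundScale (by omega)]
  have h5R : (2 : ℝ) ≤ N := by exact_mod_cast h5
  -- This replaces log N by log(k_N - 1), so that the bound depends on k_N alone.
  have h3R : (N : ℝ) ≤ (k N : ℝ) - 1 := by
    have : ((N + 1 : ℕ) : ℝ) ≤ k N := by exact_mod_cast h3
    push_cast at this
    linarith
  have hR : 0 ≤ ((k N : ℝ) - 1) ^ (1 - b) / (b - 1) :=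
    div_nonneg (Real.rpow_nonneg (by linarith) _) (by linarith)
  have hlogN : 0 ≤ Real.log N := Real.log_nonneg (by linarith)
  gcongr

end AlmostSure

end REM

end

theorem corollary3p1 {Ω : Type*} [MeasurableSpace Ω] (P : Measure Ω) [IsProbabilityMeasure P]
    (β : ℝ) (hβ : 1 < β / REM.betaC)
    (k : ℕ → ℕ) (hk : Tendsto k atTop atTop)
    (hkN : Tendsto (fun N : ℕ => (k N : ℝ) / (N : ℝ)) atTop atTop)
    (hlogk : Tendsto (fun N : ℕ => Real.log (k N : ℝ) / (N : ℝ)) atTop (𝓝 0)) :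
    -- energies that are, for each `N`, i.i.d. centred Gaussians of variance `N`
    (∀ H : (N : ℕ) → REM.Config N → Ω → ℝ,
      (∀ N, iIndepFun (H N) P) →
      (∀ N σ, HasLaw (H N σ) (gaussianReal 0 (N : NNReal)) P) →
      ∀ᵐ ω ∂P, ∀ᶠ N : ℕ in atTop, ∀ e : Fin (2 ^ N) ≃ REM.Config N,
        REM.IsEnergyOrdering (fun σ => H N σ ω) e →
        REM.dTV (REM.gibbs β fun σ => H N σ ω) (REM.truncGibbs β (fun σ => H N σ ω) e (k N)) ≤
          4 / (β / REM.betaC - 1) *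
            (1 / ((k N : ℝ) - 1) ^ ((β / REM.betaC - 1) / 2))) ∧
    -- in particular, energies built from i.i.d. standard Gaussian couplings
    (∀ J : (N : ℕ) → Finset (Fin N) → Ω → ℝ,
      (∀ N, iIndepFun (J N) P) →
      (∀ N α, HasLaw (J N α) (gaussianReal 0 1) P) →
      ∀ᵐ ω ∂P, ∀ᶠ N : ℕ in atTop, ∀ e : Fin (2 ^ N) ≃ REM.Config N,
        REM.IsEnergyOrdering (REM.hamiltonian fun α => J N α ω) e →
        REM.dTV (REM.gibbs β (REM.hamiltonian fun α => J N α ω))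
            (REM.truncGibbs β (REM.hamiltonian fun α => J N α ω) e (k N)) ≤
          4 / (β / REM.betaC - 1) *
            (1 / ((k N : ℝ) - 1) ^ ((β / REM.betaC - 1) / 2))) := by
  have hk1 : ∀ᶠ N : ℕ in atTop, N + 1 ≤ k N := by
    filter_upwards [hkN.eventually_ge_atTop 2, eventually_ge_atTop 1] with N h1 h2
    have hN : (1 : ℝ) ≤ N := by exact_mod_cast h2
    rw [le_div_iff₀ (by linarith)] at h1
    have : ((N + 1 : ℕ) : ℝ) ≤ k N := by push_cast; linarith
    exact_mod_cast this
  have hb : β / REM.betaC * REM.betaC = β := div_mul_cancel₀ _ REM.betaC_pos.ne'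
  have main := fun H hH hl => REM.ae_eventually_dTV_le (P := P) hβ hk1 (H := H) hH hl
  rw [hb] at main
  exact ⟨main, fun J hJ hJl => main (fun N σ ω => REM.hamiltonian (fun α => J N α ω) σ)
    (fun N => REM.iIndepFun_hamiltonian (hJ N) (hJl N))
    fun N σ => REM.hasLaw_hamiltonian (hJ N) (hJl N) σ⟩
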